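/- Let $k\ge 1$ be an integer. For real $\alpha$, Erdélyi's multivariate Laguerre polynomials $L^{(\alpha)}_{n_1,\dots,n_k}(\mathbf x)$, where $\mathbf x=(x_1,\dots,x_k)\in\mathbb R^k$ and $n_1,\dots,n_k\in\mathbb Z_{\ge 0}$, are defined by the generating function $$(1-z_1-\cdots-z_k)^{-\alpha-1}\exp\left(-\frac{x_1z_1+\cdots+x_kz_k}{1-z_1-\cdots-z_k}\right)=\sum_{n_1,\dots,n_k=0}^{\infty}L^{(\alpha)}_{n_1,\dots,n_k}(\mathbf x)\,z_1^{n_1}\cdots z_k^{n_k},\qquad |z_1|+\cdots+|z_k|<1 .$$ Write $(a)_n=a(a+1)\cdots(a+n-1)$, $\|\mathbf x\|=\max_{1\le j\le k}|x_j|$, and $$q_n=\frac{((2n)!)^{1/2}}{2^{n+1/2}\,n!}.$$ Theorem. Let $\alpha>-\tfrac12$ and $x_1,\dots,x_k\ge 0$. Then for all $n_1,\dots,n_k\in\mathbb Z_{\ge 0}$, $$\left|L^{(\alpha)}_{n_1,\dots,n_k}(\mathbf x)\right|\le q_{n_1}\cdots q_{n_k}\,2^{k-1/2}\,\frac{(\alpha+1)_{n_1+\cdots+n_k}}{\left(\frac1{2k}\right)_{n_1}\cdots\left(\frac1{2k}\right)_{n_k}}\,e^{\|\mathbf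 x\|/2}.$$ -/

import Mathlib

noncomputable section

namespace ErdelyiLaguerre

/-- The formal power series `z₁ + ⋯ + z_k`. -/
def zSum (k : ℕ) : MvPowerSeries (Fin k) ℝ :=
  ∑ j, MvPowerSeries.X j

/-- The formal power series `x₁ z₁ + ⋯ + x_k z_k`. -/
def xzSum {k : ℕ} (x : Fin k → ℝ) : MvPowerSeries (Fin k) ℝ :=
  ∑ j, MvPowerSeries.C (x j) * MvPowerSeries.X j

/-- The series substituted into the exponential has no constant term, so the substitution in
`generatingSeries` is a genuine one. -/
theorem hasSubst_exponent {k : ℕ} (x : Fin k → ℝ) :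
    PowerSeries.HasSubst (-(xzSum x * (1 - zSum k)⁻¹)) :=
  PowerSeries.HasSubst.of_constantCoeff_zero (by simp [xzSum])

/-- Likewise for the series substituted into the binomial series. -/
theorem hasSubst_neg_zSum (k : ℕ) : PowerSeries.HasSubst (-zSum k) :=
  PowerSeries.HasSubst.of_constantCoeff_zero (by simp [zSum])

/-- `1 - z₁ - ⋯ - z_k` is invertible as a formal power series. -/
theorem one_sub_zSum_mul_inv (k : ℕ) : (1 - zSum k) * (1 - zSum k)⁻¹ = 1 :=
  MvPowerSeries.mul_inv_cancel _ (by simp [zSum])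

/-- The generating function
`(1 - z₁ - ⋯ - z_k)^(-α-1) * exp (-(x₁ z₁ + ⋯ + x_k z_k) / (1 - z₁ - ⋯ - z_k))`
as a power series in `z₁, …, z_k`: the binomial series `(1 + X)^(-α-1)` at
`X = -(z₁ + ⋯ + z_k)`, times the exponential series at the exponent. -/
def generatingSeries {k : ℕ} (α : ℝ) (x : Fin k → ℝ) : MvPowerSeries (Fin k) ℝ :=
  (PowerSeries.binomialSeries ℝ (-α - 1)).subst (-zSum k) *
    (PowerSeries.exp ℝ).subst (-(xzSum x * (1 - zSum k)⁻¹))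

/-- Erdélyi's multivariate Laguerre polynomial `L^(α)_{n₁,…,n_k}(x₁,…,x_k)`: the coefficient of
`z₁^n₁ ⋯ z_k^n_k` in the generating function. -/
def laguerre {k : ℕ} (α : ℝ) (n : Fin k → ℕ) (x : Fin k → ℝ) : ℝ :=
  MvPowerSeries.coeff (Finsupp.equivFunOnFinite.symm n) (generatingSeries α x)

/-- The Pochhammer symbol `(a)_n = a (a + 1) ⋯ (a + n - 1)`. -/
def poch (a : ℝ) (n : ℕ) : ℝ := (ascPochhammer ℝ n).eval a

/-- `q_n = ((2n)!)^(1/2) / (2^(n+1/2) n!)`. -/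
def q (n : ℕ) : ℝ :=
  Real.sqrt ((2 * n).factorial : ℝ) / ((2 : ℝ) ^ ((n : ℝ) + 1 / 2) * (n.factorial : ℝ))

end ErdelyiLaguerre

end

/-! ### Pochhammer symbols, and the Sonin function of the even Hermite functions. -/

noncomputable section

namespace ErdelyiLaguerre

open Polynomial Filter Topology

/-! Expanding the generating function gives an explicit sum (`laguerre_eq_sum`) in which the
variables are coupled only through the factor `1 / (α+1)_{|p|}`. Dirichlet moments remove the
coupling: with weight `a = 1/(2k)` on each of the `k` coordinates and `α + 1/2` on the slack, the
total weight is `α + 1`, and the mean of `∏ t_j ^ p_j` is `∏ (a)_{p_j} / (α+1)_{|p|}`. Hence the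
polynomial is `(α+1)_{|n|}` times the Dirichlet mean of a product of one-variable Laguerre
polynomials of parameter `a - 1` at `x_j t_j`, and a uniform bound on the simplex passes to the mean
(`abs_sum_dirichlet_le`).

The one-variable bound is Rooney's (`abs_poch_mul_laguerreSum_le`). A Weyl fractional integral
reduces parameter `a - 1` to parameter `-1/2`, where the polynomials are even Hermite polynomials in
the square root of the variable, and `cramer_indritz` applies. That inequality comes from a
decreasing Sonin function on `[0, 4m - 1]`, and beyond this interval from the impossibility of an
interior maximum. Finally `∑ x_j t_j ≤ ‖x‖` on the simplex, and the `k` factors `2^(1-a)` multiply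
to `2^(k-1/2)`. -/

@[simp] lemma poch_zero (a : ℝ) : poch a 0 = 1 := by simp [poch]

lemma poch_succ (a : ℝ) (n : ℕ) : poch a (n + 1) = poch a n * (a + n) :=
  ascPochhammer_succ_eval n a

lemma poch_pos {a : ℝ} (ha : 0 < a) (n : ℕ) : 0 < poch a n :=
  ascPochhammer_pos n a ha

lemma poch_add (a : ℝ) (m n : ℕ) : poch a (m + n) = poch a m * poch (a + m) n := by
  induction n with
  | zero => simp
  | succ n ih => rw [← add_assoc, poch_succ, ih, poch_succ]; push_cast; ring

lemma poch_eq_smeval (a : ℝ) (n : ℕ) : poch a n = (ascPochhammer ℕ n).smeval a :=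
  (ascPochhammer_smeval_eq_eval a n).symm

lemma multichoose_eq_poch (a : ℝ) (n : ℕ) :
    Ring.multichoose a n = poch a n / n.factorial := by
  rw [poch_eq_smeval, ← Ring.factorial_nsmul_multichoose_eq_ascPochhammer, nsmul_eq_mul]
  field_simp

lemma choose_neg_eq_poch (a : ℝ) (n : ℕ) :
    Ring.choose (-a) n = (-1) ^ n * (poch a n / n.factorial) := by
  rw [Ring.choose_neg', multichoose_eq_poch, Units.smul_def, zsmul_eq_mul,
    Int.cast_negOnePow_natCast]

lemma choose_add_sub_one_eq_poch (b : ℝ) (n : ℕ) :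
    Ring.choose (b + n - 1) n = poch b n / n.factorial := by
  rw [← Ring.multichoose_eq, multichoose_eq_poch]

lemma Gamma_add_nat {a : ℝ} (ha : 0 < a) (n : ℕ) :
    Real.Gamma (a + n) = poch a n * Real.Gamma a := by
  induction n with
  | zero => simp
  | succ n ih =>
    have : a + n ≠ 0 := by positivity
    rw [poch_succ, Nat.cast_succ, ← add_assoc, Real.Gamma_add_one this, ih]; ring

/-- The Laguerre polynomial `L_m^(-1/2)` divided by its value at `0`. -/
def evenHermite (m : ℕ) : ℝ[X] :=
  ∑ j ∈ Finset.range (m + 1), C ((-1) ^ j * (m.choose j : ℝ) / poch (1 / 2) j) * X ^ j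

lemma coeff_evenHermite (m j : ℕ) :
    (evenHermite m).coeff j = (-1) ^ j * (m.choose j : ℝ) / poch (1 / 2) j := by
  simp only [evenHermite, finsetSum_coeff, coeff_C_mul_X_pow, Finset.sum_ite_eq,
    Finset.mem_range]
  split_ifs with h
  · rfl
  · rw [Nat.choose_eq_zero_of_lt (by omega)]; simp

lemma natDegree_evenHermite_le (m : ℕ) : (evenHermite m).natDegree ≤ m :=
  natDegree_le_iff_coeff_eq_zero.2 fun j hj => by
    rw [coeff_evenHermite, Nat.choose_eq_zero_of_lt hj]; simp

lemma eval_zero_evenHermite (m : ℕ) : (evenHermite m).eval 0 = 1 := by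
  rw [← coeff_zero_eq_eval_zero, coeff_evenHermite]; simp

/-- Kummer's equation; coefficientwise it is the ratio of consecutive coefficients, isolated as
`key`. -/
lemma evenHermite_ode (m : ℕ) :
    X * derivative (derivative (evenHermite m)) + (C (1 / 2) - X) * derivative (evenHermite m)
      + C (m : ℝ) * evenHermite m = 0 := by
  ext j
  have hp : poch (1 / 2) j ≠ 0 := (poch_pos (by norm_num) j).ne'
  have hq : (1 / 2 + j : ℝ) ≠ 0 := by positivity
  have hc : ((m.choose (j + 1) : ℝ)) * (j + 1) = m.choose j * (m - j) := by
    rcases le_or_gt j m with h | h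
    · have := Nat.choose_succ_right_eq m j
      rw [← Nat.cast_sub h]; exact_mod_cast this
    · rw [Nat.choose_eq_zero_of_lt h, Nat.choose_eq_zero_of_lt (by omega)]; simp
  have key : (1 / 2 + j : ℝ) * ((j + 1) * (evenHermite m).coeff (j + 1))
      = (j - m) * (evenHermite m).coeff j := by
    rw [coeff_evenHermite, coeff_evenHermite, poch_succ, pow_succ]
    field_simp
    linear_combination (-(1:ℝ)) * hc
  cases j with
  | zero =>
    simp only [sub_mul, coeff_add, coeff_sub, coeff_X_mul_zero, coeff_C_mul, coeff_derivative,
      coeff_zero]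
    push_cast at key ⊢
    linear_combination key
  | succ j =>
    simp only [sub_mul, coeff_add, coeff_sub, coeff_X_mul, coeff_C_mul, coeff_derivative,
      coeff_zero]
    push_cast at key ⊢
    linear_combination key

lemma evenHermite_ode_eval (m : ℕ) (y : ℝ) :
    y * (derivative (derivative (evenHermite m))).eval y
      + (1 / 2 - y) * (derivative (evenHermite m)).eval y + m * (evenHermite m).eval y = 0 := by
  simpa using congrArg (eval y) (evenHermite_ode m)

/-- The Sonin function of the even Hermite functions, built on the WKB amplitude
`(4 m + 1 - y) ^ (-1 / 4)`. -/
def sonin (m : ℕ) (y : ℝ) : ℝ :=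
  √(4 * m + 1 - y) * Real.exp (-y) * ((evenHermite m).eval y ^ 2 +
    y * (4 * (4 * m + 1 - y) * (derivative (evenHermite m)).eval y
      - (2 * (4 * m + 1 - y) + 1) * (evenHermite m).eval y) ^ 2 /
    (4 * (4 * m + 1 - y) ^ 3 + 2 * (4 * m + 1 - y) + 5 * y))

/-- Put `y = x²`, `Q = 4m + 1 - y`, so that `u = e^(-y/2) P` solves `u'' + Q u = 0` in `x`. Then `v
= Q^(1/4) u` solves an equation with zeroth-order coefficient `φ = D / (4 Q²)`, and `sonin` is `v² +
v'² / φ`; `G` is `v'` up to explicit factors. Its derivative is a nonpositive multiple of `G²`. -/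
lemma hasDerivAt_sonin (m : ℕ) {y : ℝ} (hy : 0 ≤ y) (hy' : y < 4 * m + 1) :
    ∃ c : ℝ, c ≤ 0 ∧ HasDerivAt (sonin m) c y := by
  set Q := 4 * (m : ℝ) + 1 - y with hQ
  have hQ0 : 0 < Q := by linarith
  set P := (evenHermite m).eval y
  set P1 := (derivative (evenHermite m)).eval y
  set P2 := (derivative (derivative (evenHermite m))).eval y
  have ode : y * P2 + (1 / 2 - y) * P1 + m * P = 0 := evenHermite_ode_eval m y
  set G := 4 * Q * P1 - (2 * Q + 1) * P with hG
  set D := 4 * Q ^ 3 + 2 * Q + 5 * y with hD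
  have hD0 : 0 < D := by positivity
  have dQ : HasDerivAt (fun z : ℝ => 4 * (m : ℝ) + 1 - z) (-1) y := by
    simpa using (hasDerivAt_id y).const_sub (4 * (m : ℝ) + 1)
  have dP := (evenHermite m).hasDerivAt y
  have dP1 := (derivative (evenHermite m)).hasDerivAt y
  have dG : HasDerivAt (fun z : ℝ => 4 * (4 * (m : ℝ) + 1 - z) * (derivative (evenHermite m)).eval z
      - (2 * (4 * (m : ℝ) + 1 - z) + 1) * (evenHermite m).eval z)
      (4 * Q * P2 - 4 * P1 - (2 * Q + 1) * P1 + 2 * P) y := by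
    refine (((dQ.const_mul 4).mul dP1).sub (((dQ.const_mul 2).add_const 1).mul dP)).congr_deriv ?_
    ring
  have dD : HasDerivAt (fun z : ℝ => 4 * (4 * (m : ℝ) + 1 - z) ^ 3 + 2 * (4 * (m : ℝ) + 1 - z)
      + 5 * z) (3 - 12 * Q ^ 2) y := by
    refine ((((dQ.pow 3).const_mul 4).add (dQ.const_mul 2)).add
      ((hasDerivAt_id y).const_mul 5)).congr_deriv ?_
    simp only [Nat.cast_ofNat, ← hQ]; ring
  have dS := ((dQ.sqrt hQ0.ne').mul ((hasDerivAt_id y).neg.exp)).mul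
    ((dP.pow 2).add (((hasDerivAt_id y).mul (dG.pow 2)).div dD hD0.ne'))
  refine ⟨-(Real.exp (-y) / √Q * (y * G ^ 2 * (9 * Q + 15 * y) / D ^ 2)), ?_, ?_⟩
  · have : 0 ≤ Real.exp (-y) / √Q * (y * G ^ 2 * (9 * Q + 15 * y) / D ^ 2) := by positivity
    linarith
  · refine dS.congr_deriv ?_
    simp only [id, Nat.cast_ofNat, ← hQ, ← hD, Pi.mul_apply, Pi.pow_apply, Pi.neg_apply,
      Pi.add_apply, Pi.div_apply]
    have hs : √Q ≠ 0 := (Real.sqrt_pos.2 hQ0).ne'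
    have hs2 : √Q ^ 2 = Q := Real.sq_sqrt hQ0.le
    have hm : (m : ℝ) = (Q + y - 1) / 4 := by rw [hQ]; ring
    -- Multiplying by `y` lets the equation eliminate `P2` without dividing by `y`, which may be
    -- zero.
    have yG : y * (4 * Q * P2 - 4 * P1 - (2 * Q + 1) * P1 + 2 * P)
        = 4 * Q * (-(1 / 2 - y) * P1 - (Q + y - 1) / 4 * P) - y * (2 * Q + 5) * P1 + 2 * y * P := by
      rw [hm] at ode
      linear_combination (4 * Q) * ode
    generalize hG1 : 4 * Q * P2 - 4 * P1 - (2 * Q + 1) * P1 + 2 * P = G1 at yG ⊢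
    have hR : 2 * P * P1 + ((G ^ 2 + y * (2 * G * G1)) * D - y * G ^ 2 * (3 - 12 * Q ^ 2)) / D ^ 2
        - (P ^ 2 + y * G ^ 2 / D) - (P ^ 2 + y * G ^ 2 / D) / (2 * Q)
        = -(y * G ^ 2 * (9 * Q + 15 * y) / (Q * D ^ 2)) := by
      rw [show y * (2 * G * G1) = 2 * G * (y * G1) by ring, yG]
      field_simp
      rw [hG, hD]
      ring
    change (-1 / (2 * √Q) * Real.exp (-y) + √Q * (Real.exp (-y) * -1)) *
        (P ^ 2 + y * G ^ 2 / D) + √Q * Real.exp (-y) * (2 * P ^ (2 - 1) * P1 +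
          ((1 * G ^ 2 + y * (2 * G ^ (2 - 1) * G1)) * D - y * G ^ 2 * (3 - 12 * Q ^ 2)) / D ^ 2) = _
    have e1 : -1 / (2 * √Q) = -(√Q / (2 * Q)) := by
      rw [← hs2]; field_simp; rw [Real.sqrt_sq (Real.sqrt_nonneg Q)]
    have e2 : Real.exp (-y) / √Q * (y * G ^ 2 * (9 * Q + 15 * y) / D ^ 2)
        = √Q * Real.exp (-y) * (y * G ^ 2 * (9 * Q + 15 * y) / (Q * D ^ 2)) := by
      field_simp; rw [hs2]; ring
    rw [e1, e2]
    linear_combination (√Q * Real.exp (-y)) * hR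

end ErdelyiLaguerre

end

/-! ### The Cramér–Indritz inequality. -/

noncomputable section

namespace ErdelyiLaguerre

open Polynomial Filter Topology

lemma antitoneOn_sonin (m : ℕ) : AntitoneOn (sonin m) (Set.Icc 0 (4 * m - 1)) := by
  have hd : ∀ y ∈ Set.Icc (0 : ℝ) (4 * m - 1), ∃ c : ℝ, c ≤ 0 ∧ HasDerivAt (sonin m) c y :=
    fun y hy => hasDerivAt_sonin m hy.1 (by linarith [hy.2])
  refine antitoneOn_of_deriv_nonpos (convex_Icc _ _) (fun y hy => ?_) (fun y hy => ?_)
    (fun y hy => ?_)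
  · obtain ⟨c, -, h⟩ := hd y hy
    exact h.continuousAt.continuousWithinAt
  · obtain ⟨c, -, h⟩ := hd y (interior_subset hy)
    exact h.differentiableAt.differentiableWithinAt
  · obtain ⟨c, hc, h⟩ := hd y (interior_subset hy)
    rw [h.deriv]; exact hc

/-- The Sonin function equals `√(4m+1)` at the origin, and its first term carries the factor `√Q ≥
√2` as long as `y ≤ 4m - 1`. -/
lemma sq_evenHermite_mul_exp_le_sqrt (m : ℕ) {y : ℝ} (hy : 0 ≤ y) (hy' : y ≤ 4 * m - 1) :
    (evenHermite m).eval y ^ 2 * Real.exp (-y) ≤ √((4 * m + 1) / 2) := by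
  have h1 := antitoneOn_sonin m ⟨le_rfl, hy.trans hy'⟩ ⟨hy, hy'⟩ hy
  have h0 : sonin m 0 = √(4 * m + 1) := by simp [sonin, eval_zero_evenHermite]
  have h2 : √2 * ((evenHermite m).eval y ^ 2 * Real.exp (-y)) ≤ sonin m y := by
    have hQ : (2 : ℝ) ≤ 4 * m + 1 - y := by linarith
    have : 0 ≤ 4 * (m : ℝ) + 1 - y := by linarith
    rw [sonin, mul_assoc, mul_comm ((evenHermite m).eval y ^ 2)]
    gcongr
    exact le_add_of_nonneg_right (by positivity)
  rw [Real.sqrt_div (by positivity), le_div_iff₀ (by positivity)]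
  linarith

/-- The classical central binomial estimate; the form `3m + 1` is what makes the induction close. -/
lemma sq_poch_half_div_factorial_le (m : ℕ) :
    (poch (1 / 2) m / m.factorial) ^ 2 * (3 * m + 1) ≤ 1 := by
  induction m with
  | zero => simp
  | succ m ih =>
    have e : poch (1 / 2) (m + 1) / (m + 1).factorial
        = poch (1 / 2) m / m.factorial * ((1 / 2 + m) / (m + 1)) := by
      rw [poch_succ, Nat.factorial_succ]; push_cast; field_simp
    rw [e]
    refine le_trans ?_ ih
    rw [mul_pow, mul_assoc]
    gcongr
    rw [div_pow, div_mul_eq_mul_div, div_le_iff₀ (by positivity)]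
    push_cast
    nlinarith [(Nat.cast_nonneg m : (0 : ℝ) ≤ m)]

/-- A solution of the differential equation of `evenHermite m` of degree at most `m`, positive at
a point `z ≥ 4 m - 1`, cannot grow there faster than `y ^ ((4 m - 1) / 2)`. -/
lemma not_growth_of_ode {m : ℕ} (hm : 1 ≤ m) {f : ℝ[X]} (hdeg : f.natDegree ≤ m)
    (ode : ∀ y, y * (derivative (derivative f)).eval y
      + (1 / 2 - y) * (derivative f).eval y + m * f.eval y = 0)
    {z : ℝ} (hz : 4 * m - 1 ≤ z) (hpos : 0 < f.eval z)
    (hg : 0 < 2 * z * (derivative f).eval z - (4 * m - 1) * f.eval z) : False := by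
  have hm1 : (1 : ℝ) ≤ m := by exact_mod_cast hm
  have hz0 : 0 < z := by linarith
  set g : ℝ → ℝ := fun y => 2 * y * (derivative f).eval y - (4 * m - 1) * f.eval y with hgdef
  have dg : ∀ y, HasDerivAt g (2 * (derivative f).eval y + 2 * y * (derivative (derivative f)).eval y
      - (4 * m - 1) * (derivative f).eval y) y := fun y => by
    refine ((((hasDerivAt_id y).const_mul 2).mul ((derivative f).hasDerivAt y)).sub
      ((f.hasDerivAt y).const_mul (4 * (m : ℝ) - 1))).congr_deriv ?_
    simp
  have cf : Continuous fun y => f.eval y := f.continuous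
  have cg : Continuous g := continuous_iff_continuousAt.2 fun y => (dg y).continuousAt
  have df_pos : ∀ y, z ≤ y → 0 < f.eval y → 0 < g y → 0 < (derivative f).eval y := by
    intro y hy h1 h2
    have : 0 < 2 * y * (derivative f).eval y := by
      have : 0 < (4 * (m : ℝ) - 1) * f.eval y := mul_pos (by linarith) h1
      simp only [hgdef] at h2; linarith
    exact (mul_pos_iff_of_pos_left (by linarith)).1 this
  have dg_nonneg : ∀ y, z ≤ y → 0 < f.eval y → 0 < g y →
      0 ≤ 2 * (derivative f).eval y + 2 * y * (derivative (derivative f)).eval y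
      - (4 * m - 1) * (derivative f).eval y := by
    intro y hy h1 h2
    have hy0 : 0 < y := by linarith
    -- The differential equation expresses `y g'` through `g` and `f` with coefficients that are
    -- nonnegative for `y ≥ 4m - 1`.
    have e : y * (2 * (derivative f).eval y + 2 * y * (derivative (derivative f)).eval y
        - (4 * m - 1) * (derivative f).eval y)
        = (2 * y + 2 - 4 * m) / 2 * g y + (2 * m - 1) * (y - (4 * m - 1)) * f.eval y := by
      simp only [hgdef]
      linear_combination (2 * y) * ode y
    have : 0 ≤ (2 * y + 2 - 4 * m) / 2 * g y + (2 * m - 1) * (y - (4 * m - 1)) * f.eval y := by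
      have a1 : 0 ≤ (2 * y + 2 - 4 * m) / 2 := by linarith
      have a2 : 0 ≤ (2 * (m : ℝ) - 1) := by linarith
      have a3 : 0 ≤ y - (4 * m - 1) := by linarith
      positivity
    rw [← e] at this
    exact nonneg_of_mul_nonneg_right this hy0
  -- Positivity of `f` and `g` persists: up to a first failure point `v` both are nondecreasing, so
  -- neither can have dropped to zero at `v`.
  have main : ∀ y, z ≤ y → 0 < f.eval y ∧ 0 < g y := by
    by_contra! hcon
    obtain ⟨w, hzw, hw⟩ := hcon
    let S : Set ℝ := {y | z ≤ y ∧ min (f.eval y) (g y) ≤ 0}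
    have hSc : IsClosed S :=
      (isClosed_le continuous_const continuous_id).inter
        (isClosed_le (cf.min cg) continuous_const)
    have hSne : S.Nonempty := ⟨w, hzw, by
      by_contra! h
      rw [lt_min_iff] at h
      exact absurd (hw h.1) (not_le.2 h.2)⟩
    have hSb : BddBelow S := ⟨z, fun y hy => hy.1⟩
    have hv := hSc.csInf_mem hSne hSb
    set v := sInf S
    have hbelow : ∀ y ∈ Set.Ico z v, 0 < f.eval y ∧ 0 < g y := fun y hy => by
      by_contra h
      refine absurd (csInf_le hSb (show y ∈ S from ⟨hy.1, ?_⟩)) (not_le.2 hy.2)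
      by_contra! h'
      exact h (lt_min_iff.1 h')
    have mf : MonotoneOn (fun y => f.eval y) (Set.Icc z v) := by
      refine monotoneOn_of_deriv_nonneg (convex_Icc _ _) cf.continuousOn
        f.differentiable.differentiableOn fun y hy => ?_
      rw [interior_Icc] at hy
      obtain ⟨h1, h2⟩ := hbelow y ⟨hy.1.le, hy.2⟩
      rw [Polynomial.deriv]
      exact (df_pos y hy.1.le h1 h2).le
    have mg : MonotoneOn g (Set.Icc z v) := by
      refine monotoneOn_of_deriv_nonneg (convex_Icc _ _) cg.continuousOn
        (fun y _ => (dg y).differentiableAt.differentiableWithinAt) fun y hy => ?_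
      rw [interior_Icc] at hy
      obtain ⟨h1, h2⟩ := hbelow y ⟨hy.1.le, hy.2⟩
      rw [(dg y).deriv]
      exact dg_nonneg y hy.1.le h1 h2
    have h1 := mf ⟨le_rfl, hv.1⟩ ⟨hv.1, le_rfl⟩ hv.1
    have h2 := mg ⟨le_rfl, hv.1⟩ ⟨hv.1, le_rfl⟩ hv.1
    exact absurd hv.2 (not_le.2 (lt_min (hpos.trans_le h1) (hg.trans_le h2)))
  have hinc : MonotoneOn (fun y => f.eval y ^ 2 / y ^ (4 * m - 1)) (Set.Ici z) := by
    have hd : ∀ y ∈ Set.Ici z, HasDerivAt (fun y => f.eval y ^ 2 / y ^ (4 * m - 1))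
        (f.eval y * g y / y ^ (4 * m)) y := fun y hy => by
      have hy0 : 0 < y := hz0.trans_le hy
      refine (((f.hasDerivAt y).pow 2).div (hasDerivAt_pow (4 * m - 1) y)
        (by positivity)).congr_deriv ?_
      obtain ⟨j, rfl⟩ : ∃ j, m = j + 1 := ⟨m - 1, by omega⟩
      simp only [hgdef, show 4 * (j + 1) - 1 = 4 * j + 3 by omega,
        show 4 * j + 3 - 1 = 4 * j + 2 by omega]
      push_cast
      field_simp
      simp only [Pi.pow_apply]
      ring
    refine monotoneOn_of_deriv_nonneg (convex_Ici _)
      (fun y hy => (hd y hy).continuousAt.continuousWithinAt)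
      (fun y hy => (hd y (interior_subset hy)).differentiableAt.differentiableWithinAt)
      fun y hy => ?_
    have hy' := interior_subset hy
    have hy0 : 0 < y := hz0.trans_le hy'
    rw [(hd y hy').deriv]
    obtain ⟨h1, h2⟩ := main y hy'
    positivity
  -- The degree of `f²` is at most `2m < 4m - 1`, whereas the quotient is nondecreasing and positive
  -- at `z`.
  have hlim : Tendsto (fun y => (f ^ 2).eval y / (X ^ (4 * m - 1) : ℝ[X]).eval y) atTop (𝓝 0) := by
    refine div_tendsto_atTop_zero_of_degree_lt _ _ (degree_lt_degree ?_)
    rw [natDegree_X_pow]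
    refine (natDegree_pow_le_of_le 2 hdeg).trans_lt ?_
    omega
  have : f.eval z ^ 2 / z ^ (4 * m - 1) ≤ 0 := by
    refine ge_of_tendsto hlim ?_
    filter_upwards [eventually_ge_atTop z] with y hy
    simpa using hinc (Set.mem_Ici.2 le_rfl) (Set.mem_Ici.2 hy) hy
  exact absurd this (not_le.2 (by positivity))

/-- Beyond `4 m - 1` the function `|evenHermite m| * exp (-y / 2)` has no critical point. -/
lemma evenHermite_eq_zero_of_critical {m : ℕ} (hm : 1 ≤ m) {z : ℝ} (hz : 4 * m - 1 < z)
    (hcrit : 2 * (derivative (evenHermite m)).eval z = (evenHermite m).eval z) :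
    (evenHermite m).eval z = 0 := by
  rcases lt_trichotomy ((evenHermite m).eval z) 0 with h | h | h
  · refine (not_growth_of_ode hm (f := -evenHermite m) (by
      rw [natDegree_neg]; exact natDegree_evenHermite_le m) (fun y => ?_) hz.le (by simpa using h)
      ?_).elim
    · simp only [derivative_neg, eval_neg]
      linear_combination -evenHermite_ode_eval m y
    · simp only [derivative_neg, eval_neg]
      nlinarith
  · exact h
  · refine (not_growth_of_ode hm (natDegree_evenHermite_le m) (evenHermite_ode_eval m) hz.le h
      ?_).elim
    nlinarith

lemma tendsto_sq_eval_mul_exp_neg (f : ℝ[X]) :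
    Tendsto (fun y => f.eval y ^ 2 * Real.exp (-y)) atTop (𝓝 0) := by
  have := Polynomial.tendsto_div_exp_atTop (f ^ 2)
  simp only [eval_pow, div_eq_mul_inv, ← Real.exp_neg] at this
  exact this

/-- A violation beyond `4m - 1` would force an interior maximum there, since the left endpoint obeys
the Sonin bound and the function decays at infinity; but a critical point there is a zero. -/
lemma sq_evenHermite_mul_exp_le {m : ℕ} (hm : 1 ≤ m) {y : ℝ} (hy : 0 ≤ y) :
    (evenHermite m).eval y ^ 2 * Real.exp (-y) ≤ √((4 * m + 1) / 2) := by
  have hm1 : (1 : ℝ) ≤ m := by exact_mod_cast hm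
  rcases le_or_gt y (4 * m - 1) with h | h
  · exact sq_evenHermite_mul_exp_le_sqrt m hy h
  set F : ℝ → ℝ := fun y => (evenHermite m).eval y ^ 2 * Real.exp (-y) with hF
  by_contra! hlt
  have hB : 0 ≤ √((4 * (m : ℝ) + 1) / 2) := Real.sqrt_nonneg _
  have cF : Continuous F := by fun_prop
  obtain ⟨T, hT⟩ := ((tendsto_sq_eval_mul_exp_neg (evenHermite m)).eventually_lt_const
    (hB.trans_lt hlt)).exists_forall_of_atTop
  set b := max T (y + 1)
  obtain ⟨z, hz, hmax⟩ := isCompact_Icc.exists_isMaxOn (s := Set.Icc (4 * (m : ℝ) - 1) b)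
    ⟨y, h.le, (by linarith : y ≤ y + 1).trans (le_max_right _ _)⟩ cF.continuousOn
  have hyz : F y ≤ F z := hmax ⟨h.le, (by linarith : y ≤ y + 1).trans (le_max_right _ _)⟩
  have hz1 : 4 * (m : ℝ) - 1 < z := by
    refine lt_of_le_of_ne hz.1 fun he => ?_
    have := sq_evenHermite_mul_exp_le_sqrt m (y := z) (by linarith) he.symm.le
    exact absurd (hlt.trans_le hyz) (not_lt.2 this)
  have hz2 : z < b := by
    refine lt_of_le_of_ne hz.2 fun he => ?_
    exact absurd hyz (not_le.2 (hT z (he ▸ le_max_left _ _)))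
  have hloc : IsLocalMax F z := hmax.isLocalMax (Icc_mem_nhds hz1 hz2)
  have hd : HasDerivAt F ((evenHermite m).eval z * Real.exp (-z) *
      (2 * (derivative (evenHermite m)).eval z - (evenHermite m).eval z)) z := by
    refine ((((evenHermite m).hasDerivAt z).pow 2).mul
      ((hasDerivAt_id z).neg.exp)).congr_deriv ?_
    simp only [Pi.pow_apply, Pi.neg_apply, id]
    push_cast
    ring
  have h0 := hloc.hasDerivAt_eq_zero hd
  have hFz : F z ≠ 0 := (lt_of_le_of_lt hB (hlt.trans_le hyz)).ne'
  apply hFz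
  have : (evenHermite m).eval z = 0 := by
    rcases mul_eq_zero.1 h0 with h | h
    · exact (mul_eq_zero.1 h).resolve_right (Real.exp_pos _).ne'
    · exact evenHermite_eq_zero_of_critical hm hz1 (by linarith)
  simp [hF, this]

/-- The Cramér–Indritz inequality for Hermite polynomials of even degree. -/
theorem cramer_indritz (m : ℕ) {y : ℝ} (hy : 0 ≤ y) :
    poch (1 / 2) m / m.factorial * (evenHermite m).eval y ^ 2 ≤ Real.exp y := by
  rcases Nat.eq_zero_or_pos m with rfl | hm
  · simpa [evenHermite] using hy
  set c := poch (1 / 2) m / m.factorial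
  have hc : 0 ≤ c := div_nonneg (poch_pos (by norm_num) m).le (by positivity)
  have h1 := sq_evenHermite_mul_exp_le hm hy
  have h2 := sq_poch_half_div_factorial_le m
  have h3 : c * √((4 * m + 1) / 2) ≤ 1 := by
    rw [← Real.sqrt_sq hc, ← Real.sqrt_mul (by positivity), Real.sqrt_le_one]
    refine le_trans ?_ h2
    gcongr
    have : (1 : ℝ) ≤ m := by exact_mod_cast hm
    linarith
  have h4 : c * ((evenHermite m).eval y ^ 2 * Real.exp (-y)) ≤ 1 :=
    (mul_le_mul_of_nonneg_left h1 hc).trans h3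
  rw [Real.exp_neg, ← div_eq_mul_inv, ← mul_div_assoc, div_le_one (Real.exp_pos y)] at h4
  exact h4

end ErdelyiLaguerre

end

/-! ### Rooney's inequality by Weyl fractional integration. -/

noncomputable section

namespace ErdelyiLaguerre

open Finset MeasureTheory

/-- The Laguerre polynomial `L_n^(a-1)` divided by `(a)_n`. -/
def laguerreSum (a : ℝ) (n : ℕ) (y : ℝ) : ℝ :=
  ∑ p ∈ antidiagonal n, (-y) ^ p.1 / (p.1.factorial * p.2.factorial * poch a p.1)

lemma laguerreSum_half (n : ℕ) (y : ℝ) :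
    laguerreSum (1 / 2) n y = (evenHermite n).eval y / n.factorial := by
  rw [laguerreSum, Nat.sum_antidiagonal_eq_sum_range_succ_mk, evenHermite,
    Polynomial.eval_finsetSum, sum_div]
  refine sum_congr rfl fun j hj => ?_
  have hj' : j ≤ n := Nat.lt_succ_iff.1 (mem_range.1 hj)
  have hp : poch (1 / 2) j ≠ 0 := (poch_pos (by norm_num) j).ne'
  simp only [Polynomial.eval_mul, Polynomial.eval_C, Polynomial.eval_pow, Polynomial.eval_X]
  rw [Nat.cast_choose ℝ hj', neg_pow]
  field_simp

lemma poch_half (n : ℕ) : poch (1 / 2) n = (2 * n).factorial / (4 ^ n * n.factorial) := by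
  induction n with
  | zero => simp
  | succ n ih =>
    rw [poch_succ, ih, show 2 * (n + 1) = 2 * n + 1 + 1 by ring, Nat.factorial_succ,
      Nat.factorial_succ, Nat.factorial_succ]
    push_cast
    field_simp
    ring

lemma q_pos (n : ℕ) : 0 < q n := by unfold q; positivity

lemma two_mul_sq_q (n : ℕ) : 2 * q n ^ 2 = poch (1 / 2) n / n.factorial := by
  have h : ((2 : ℝ) ^ ((n : ℝ) + 1 / 2)) ^ 2 = 4 ^ n * 2 := by
    rw [← Real.rpow_natCast, ← Real.rpow_mul (by norm_num),
      show ((n : ℝ) + 1 / 2) * (2 : ℕ) = (2 * n : ℕ) + 1 by push_cast; ring,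
      Real.rpow_add_one (by norm_num), Real.rpow_natCast, pow_mul]
    norm_num
  rw [q, div_pow, mul_pow, h, Real.sq_sqrt (by positivity), poch_half]
  field_simp

lemma abs_laguerreSum_half_le (n : ℕ) {y : ℝ} (hy : 0 ≤ y) :
    |poch (1 / 2) n * laguerreSum (1 / 2) n y| ≤ √2 * q n * Real.exp (y / 2) := by
  have hq := q_pos n
  refine abs_le_of_sq_le_sq ?_ (by positivity)
  have hexp : Real.exp (y / 2) ^ 2 = Real.exp y := by rw [← Real.exp_nat_mul]; congr 1; push_cast; ring
  rw [mul_pow (√2 * q n), mul_pow (√2), Real.sq_sqrt (by norm_num), hexp, two_mul_sq_q, laguerreSum_half]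
  have h := cramer_indritz n hy
  have hp : 0 < poch (1 / 2) n := poch_pos (by norm_num) n
  calc (poch (1 / 2) n * ((evenHermite n).eval y / n.factorial)) ^ 2
      = poch (1 / 2) n / n.factorial *
        (poch (1 / 2) n / n.factorial * (evenHermite n).eval y ^ 2) := by ring
    _ ≤ _ := by gcongr

/-- The Chu–Vandermonde identity for the coefficients of Laguerre polynomials. -/
lemma sum_poch_mul_poch (b μ : ℝ) (N : ℕ) :
    ∑ p ∈ antidiagonal N, (-1) ^ p.1 * (poch μ p.1 / p.1.factorial) *
      (poch (b + p.1) p.2 / p.2.factorial) = poch (b - μ) N / N.factorial := by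
  rw [← choose_add_sub_one_eq_poch, show b - μ + N - 1 = -μ + (b + N - 1) by ring,
    Ring.add_choose_eq N (Commute.all _ _)]
  refine sum_congr rfl fun p hp => ?_
  rw [choose_neg_eq_poch, ← choose_add_sub_one_eq_poch (b + p.1)]
  have : (N : ℝ) = p.1 + p.2 := by rw [← HasAntidiagonal.mem_antidiagonal.1 hp]; push_cast; ring
  rw [this]
  congr 2
  ring

lemma sum_antidiagonal_assoc {M : Type*} [AddCommMonoid M] (n : ℕ) (f : ℕ → ℕ → ℕ → M) :
    ∑ p ∈ antidiagonal n, ∑ r ∈ antidiagonal p.1, f r.1 r.2 p.2 =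
      ∑ p ∈ antidiagonal n, ∑ r ∈ antidiagonal p.2, f p.1 r.1 r.2 := by
  rw [sum_sigma', sum_sigma']
  refine sum_bij' (fun x _ => ⟨(x.2.1, x.2.2 + x.1.2), (x.2.2, x.1.2)⟩)
    (fun x _ => ⟨(x.1.1 + x.2.1, x.2.2), (x.1.1, x.2.1)⟩) ?_ ?_ ?_ ?_ (fun _ _ => rfl) <;>
  · rintro ⟨⟨a, b⟩, ⟨c, d⟩⟩ h
    simp only [mem_sigma, HasAntidiagonal.mem_antidiagonal] at h ⊢
    obtain ⟨h1, h2⟩ := h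
    subst h2
    subst h1
    simp [add_assoc]

lemma poch_mul_laguerreSum {b : ℝ} (hb : 0 < b) (n : ℕ) (y : ℝ) :
    poch b n * laguerreSum b n y = ∑ p ∈ antidiagonal n,
      (-y) ^ p.1 / p.1.factorial * (poch (b + p.1) p.2 / p.2.factorial) := by
  rw [laguerreSum, mul_sum]
  refine sum_congr rfl fun p hp => ?_
  have := (poch_pos hb p.1).ne'
  rw [← HasAntidiagonal.mem_antidiagonal.1 hp, poch_add]
  field_simp

lemma poch_mul_laguerreSum_add {b : ℝ} (hb : 0 < b) (n : ℕ) (y s : ℝ) :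
    poch b n * laguerreSum b n (y + s) = ∑ p ∈ antidiagonal n, ∑ r ∈ antidiagonal p.2,
      (-y) ^ p.1 / p.1.factorial * ((-1) ^ r.1 / r.1.factorial *
        (poch (b + p.1 + r.1) r.2 / r.2.factorial)) * s ^ r.1 := by
  rw [poch_mul_laguerreSum hb, ← sum_antidiagonal_assoc n fun i l r =>
    (-y) ^ i / i.factorial * ((-1) ^ l / l.factorial *
        (poch (b + i + l) r / r.factorial)) * s ^ l]
  refine sum_congr rfl fun p hp => ?_
  rw [neg_add, (Commute.all (-y) (-s)).add_pow', sum_div, sum_mul]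
  refine sum_congr rfl fun r hr => ?_
  have h := HasAntidiagonal.mem_antidiagonal.1 hr
  rw [← h, Nat.cast_add, ← add_assoc, neg_pow s, nsmul_eq_mul, Nat.cast_add_choose ℝ]
  field_simp

lemma integral_gamma_moment {μ : ℝ} (hμ : 0 < μ) (l : ℕ) :
    ∫ s in Set.Ioi (0 : ℝ), s ^ (μ - 1) * Real.exp (-s) * s ^ l = poch μ l * Real.Gamma μ := by
  have h := Real.integral_rpow_mul_exp_neg_mul_Ioi (a := μ + l) (r := 1) (by positivity) one_pos
  rw [div_one, Real.one_rpow, one_mul, Gamma_add_nat hμ] at h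
  rw [← h]
  refine setIntegral_congr_fun measurableSet_Ioi fun s hs => ?_
  rw [show μ + l - 1 = (μ - 1) + l by ring, Real.rpow_add_natCast (ne_of_gt hs), one_mul]
  ring

/-- A non-integrable function has Bochner integral zero, so a positive value forces integrability.
-/
lemma integrableOn_gamma_moment {μ : ℝ} (hμ : 0 < μ) (l : ℕ) :
    IntegrableOn (fun s : ℝ => s ^ (μ - 1) * Real.exp (-s) * s ^ l) (Set.Ioi 0) :=
  .of_integral_ne_zero (by
    rw [integral_gamma_moment hμ]
    exact (mul_pos (poch_pos hμ l) (Real.Gamma_pos_of_pos hμ)).ne')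

/-- The Weyl fractional integral of a Laguerre polynomial lowers its parameter. -/
lemma integral_weyl_laguerreSum {a μ : ℝ} (ha : 0 < a) (hμ : 0 < μ) (n : ℕ) (y : ℝ) :
    ∫ s in Set.Ioi (0 : ℝ), s ^ (μ - 1) * Real.exp (-s) *
      (poch (a + μ) n * laguerreSum (a + μ) n (y + s))
      = Real.Gamma μ * (poch a n * laguerreSum a n y) := by
  have hb : 0 < a + μ := by positivity
  simp_rw [poch_mul_laguerreSum_add hb, mul_sum]
  have hint : ∀ (c : ℝ) (l : ℕ), IntegrableOn
      (fun s : ℝ => s ^ (μ - 1) * Real.exp (-s) * (c * s ^ l)) (Set.Ioi 0) := fun c l => by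
    have := (integrableOn_gamma_moment hμ l).const_mul c
    refine this.congr (Filter.Eventually.of_forall fun s => ?_)
    simp only; ring
  rw [integral_finsetSum _ fun p _ => integrable_finsetSum _ fun r _ => hint _ _]
  rw [poch_mul_laguerreSum ha, mul_sum]
  refine sum_congr rfl fun p _ => ?_
  rw [integral_finsetSum _ fun r _ => hint _ _]
  -- The gamma moments supply `(μ)_l`, and Chu–Vandermonde then lowers `a + μ + p.1` to `a + p.1`.
  have h := sum_poch_mul_poch (a + μ + p.1) μ p.2
  rw [show a + μ + p.1 - μ = a + p.1 by ring] at h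
  rw [← h, mul_sum, mul_sum]
  refine sum_congr rfl fun r _ => ?_
  have e : ∀ (c : ℝ), ∫ s in Set.Ioi (0 : ℝ), s ^ (μ - 1) * Real.exp (-s) * (c * s ^ r.1)
      = c * (poch μ r.1 * Real.Gamma μ) := fun c => by
    rw [← integral_gamma_moment hμ, ← integral_const_mul]
    congr 1; ext s; ring
  rw [e]
  ring

/-- Rooney's inequality for Laguerre polynomials with parameter in `(-1, -1/2]`. -/
theorem abs_poch_mul_laguerreSum_le {a : ℝ} (ha : 0 < a) (ha' : a ≤ 1 / 2) (n : ℕ) {y : ℝ}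
    (hy : 0 ≤ y) :
    |poch a n * laguerreSum a n y| ≤ 2 ^ (1 - a) * q n * Real.exp (y / 2) := by
  have hsqrt : √2 = (2 : ℝ) ^ (1 / 2 : ℝ) := Real.sqrt_eq_rpow 2
  rcases ha'.eq_or_lt with rfl | hlt
  · convert abs_laguerreSum_half_le n hy using 3
    rw [hsqrt]; norm_num
  set μ := 1 / 2 - a with hμdef
  have hμ : 0 < μ := by linarith
  have hΓ := Real.Gamma_pos_of_pos hμ
  have hI := Real.integral_rpow_mul_exp_neg_mul_Ioi (a := μ) (r := 1 / 2) hμ (by norm_num)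
  rw [one_div_one_div] at hI
  have hint : IntegrableOn (fun s : ℝ => s ^ (μ - 1) * Real.exp (-(1 / 2 * s))) (Set.Ioi 0) :=
    .of_integral_ne_zero (by rw [hI]; positivity)
  have hW := integral_weyl_laguerreSum ha hμ n y
  have haμ : a + μ = 1 / 2 := by rw [hμdef]; ring
  rw [haμ] at hW
  -- The growth `e^(s/2)` of the Hermite bound against `e^(-s)` leaves `e^(-s/2)`, whose gamma
  -- integral contributes `2^μ`.
  have hbd := norm_integral_le_of_norm_le (hint.const_mul (√2 * q n * Real.exp (y / 2)))
    (f := fun s => s ^ (μ - 1) * Real.exp (-s) *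
      (poch (1 / 2) n * laguerreSum (1 / 2) n (y + s)))
    ((ae_restrict_mem measurableSet_Ioi).mono fun s hs => by
      have hs0 : 0 < s := hs
      have h1 := abs_laguerreSum_half_le n (y := y + s) (by positivity)
      rw [Real.norm_eq_abs, abs_mul, abs_of_nonneg (by positivity : 0 ≤ s ^ (μ - 1) * Real.exp (-s))]
      refine (mul_le_mul_of_nonneg_left h1 (by positivity)).trans_eq ?_
      rw [add_div, Real.exp_add, show -(1 / 2 * s) = -s + s / 2 by ring, Real.exp_add]
      ring)
  rw [hW, integral_const_mul, hI, Real.norm_eq_abs, abs_mul, abs_of_pos hΓ] at hbd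
  have h2 : (2 : ℝ) ^ (1 - a) = √2 * 2 ^ μ := by
    rw [hsqrt, ← Real.rpow_add (by norm_num)]; congr 1; rw [hμdef]; ring
  rw [h2]
  refine le_of_mul_le_mul_left (hbd.trans_eq ?_) hΓ
  ring

end ErdelyiLaguerre

end

/-! ### Beta and Dirichlet averages. -/

noncomputable section

namespace ErdelyiLaguerre

open Finset MeasureTheory

lemma beta_add_nat {a b : ℝ} (ha : 0 < a) (hb : 0 < b) (m n : ℕ) :
    ProbabilityTheory.beta (a + m) (b + n) =
      poch a m * poch b n / poch (a + b) (m + n) * ProbabilityTheory.beta a b := by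
  have h : a + m + (b + n) = a + b + (m + n : ℕ) := by push_cast; ring
  have := (poch_pos (add_pos ha hb) (m + n)).ne'
  have := (Real.Gamma_pos_of_pos (add_pos ha hb)).ne'
  rw [ProbabilityTheory.beta, ProbabilityTheory.beta, h, Gamma_add_nat ha, Gamma_add_nat hb,
    Gamma_add_nat (add_pos ha hb)]
  field_simp

lemma integral_beta {a b : ℝ} (ha : 0 < a) (hb : 0 < b) :
    ∫ s in Set.Ioo (0 : ℝ) 1, s ^ (a - 1) * (1 - s) ^ (b - 1) = ProbabilityTheory.beta a b := by
  rw [ProbabilityTheory.beta_eq_betaIntegralReal a b ha hb, Complex.betaIntegral,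
    intervalIntegral.integral_of_le zero_le_one, ← integral_Ioc_eq_integral_Ioo]
  rw [← RCLike.re_eq_complex_re, ← integral_re]
  · refine setIntegral_congr_fun measurableSet_Ioc fun s hs => ?_
    simp only [RCLike.re_eq_complex_re]
    norm_cast
    rw [← Complex.ofReal_cpow hs.1.le, ← Complex.ofReal_cpow (by linarith [hs.2]), ← Complex.ofReal_mul,
      Complex.ofReal_re]
  · have := Complex.betaIntegral_convergent (u := a) (v := b) (by simpa) (by simpa)
    rwa [intervalIntegrable_iff_integrableOn_Ioc_of_le zero_le_one] at this

lemma integral_beta_moment {a b : ℝ} (ha : 0 < a) (hb : 0 < b) (m n : ℕ) :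
    ∫ s in Set.Ioo (0 : ℝ) 1, s ^ (a - 1) * (1 - s) ^ (b - 1) * (s ^ m * (1 - s) ^ n) =
      poch a m * poch b n / poch (a + b) (m + n) * ProbabilityTheory.beta a b := by
  rw [← beta_add_nat ha hb, ← integral_beta (by positivity) (by positivity)]
  refine setIntegral_congr_fun measurableSet_Ioo fun s hs => ?_
  have h0 : s ≠ 0 := hs.1.ne'
  have h1 : 1 - s ≠ 0 := (sub_pos.2 hs.2).ne'
  rw [show a + m - 1 = (a - 1) + m by ring, show b + n - 1 = (b - 1) + n by ring,
    Real.rpow_add_natCast h0, Real.rpow_add_natCast h1]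
  ring

lemma integrableOn_beta_moment {a b : ℝ} (ha : 0 < a) (hb : 0 < b) (m n : ℕ) :
    IntegrableOn (fun s : ℝ => s ^ (a - 1) * (1 - s) ^ (b - 1) * (s ^ m * (1 - s) ^ n))
      (Set.Ioo 0 1) :=
  .of_integral_ne_zero (by
    rw [integral_beta_moment ha hb]
    exact (mul_pos (div_pos (mul_pos (poch_pos ha m) (poch_pos hb n))
      (poch_pos (add_pos ha hb) _)) (ProbabilityTheory.beta_pos ha hb)).ne')

/-- A bound for a bivariate polynomial in `s` and `1 - s` passes to its beta average. -/
lemma abs_sum_beta_le {ι : Type*} (S : Finset ι) (c : ι → ℝ) (m n : ι → ℕ) {a b M : ℝ}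
    (ha : 0 < a) (hb : 0 < b)
    (h : ∀ s ∈ Set.Ioo (0 : ℝ) 1, |∑ i ∈ S, c i * (s ^ m i * (1 - s) ^ n i)| ≤ M) :
    |∑ i ∈ S, c i * (poch a (m i) * poch b (n i) / poch (a + b) (m i + n i))| ≤ M := by
  have hB := ProbabilityTheory.beta_pos ha hb
  have hint := integrableOn_beta_moment ha hb 0 0
  have hI := integral_beta_moment ha hb 0 0
  simp only [pow_zero, mul_one, poch_zero, add_zero, div_one, one_mul] at hint hI
  have hbd := norm_integral_le_of_norm_le (hint.const_mul M)
    (f := fun s => ∑ i ∈ S, c i * (s ^ (a - 1) * (1 - s) ^ (b - 1) *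
      (s ^ m i * (1 - s) ^ n i)))
    ((ae_restrict_mem measurableSet_Ioo).mono fun s hs => by
      have h0 : 0 ≤ s := hs.1.le
      have h1 : 0 ≤ 1 - s := sub_nonneg.2 hs.2.le
      have hw : 0 ≤ s ^ (a - 1) * (1 - s) ^ (b - 1) := by positivity
      have e : ∑ i ∈ S, c i * (s ^ (a - 1) * (1 - s) ^ (b - 1) * (s ^ m i * (1 - s) ^ n i))
          = s ^ (a - 1) * (1 - s) ^ (b - 1) * ∑ i ∈ S, c i * (s ^ m i * (1 - s) ^ n i) := by
        rw [mul_sum]; exact sum_congr rfl fun i _ => by ring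
      rw [e, Real.norm_eq_abs, abs_mul, abs_of_nonneg hw, mul_comm]
      exact mul_le_mul_of_nonneg_right (h s hs) hw)
  rw [integral_const_mul, hI,
    integral_finsetSum _ fun i _ => (integrableOn_beta_moment ha hb _ _).const_mul _] at hbd
  simp_rw [integral_const_mul, integral_beta_moment ha hb, ← mul_assoc] at hbd
  rw [← sum_mul, Real.norm_eq_abs, abs_mul, abs_of_pos hB] at hbd
  simpa only [mul_div_assoc, mul_assoc] using le_of_mul_le_mul_right hbd hB

/-- A bound for a polynomial on the simplex passes to its Dirichlet average. -/
theorem abs_sum_dirichlet_le {ι : Type*} (S : Finset ι) {M a₀ : ℝ} (ha₀ : 0 < a₀) :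
    ∀ {k : ℕ} (a : Fin k → ℝ) (_ : ∀ j, 0 < a j) (m : ι → Fin k → ℕ) (c : ι → ℝ)
      (_ : ∀ t : Fin k → ℝ, (∀ j, 0 ≤ t j) → ∑ j, t j ≤ 1 →
        |∑ i ∈ S, c i * ∏ j, t j ^ m i j| ≤ M),
      |∑ i ∈ S, c i * ((∏ j, poch (a j) (m i j)) / poch (a₀ + ∑ j, a j) (∑ j, m i j))| ≤ M := by
  intro k
  induction k with
  | zero =>
    intro a ha m c h
    simpa using h 0 (by simp) (by simp)
  | succ k ih =>
    intro a ha m c h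
    have hb : 0 < a₀ + ∑ j, a (Fin.succ j) :=
      add_pos_of_pos_of_nonneg ha₀ (sum_nonneg fun j _ => (ha _).le)
    have key := abs_sum_beta_le S
      (fun i => c i * ((∏ j, poch (a (Fin.succ j)) (m i (Fin.succ j))) /
        poch (a₀ + ∑ j, a (Fin.succ j)) (∑ j, m i (Fin.succ j))))
      (fun i => m i 0) (fun i => ∑ j, m i (Fin.succ j)) (M := M) (ha 0) hb fun s hs => by
        have h0 : 0 ≤ s := hs.1.le
        have h1 : 0 ≤ 1 - s := sub_nonneg.2 hs.2.le
        have := ih (fun j => a (Fin.succ j)) (fun j => ha _) (fun i j => m i (Fin.succ j))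
          (fun i => c i * (s ^ m i 0 * (1 - s) ^ ∑ j, m i (Fin.succ j))) fun t ht ht1 => by
            -- Stick-breaking: the first coordinate is `s`, and the others are a point of the lower
            -- simplex scaled by `1 - s`.
            have := h (Fin.cons s fun j => (1 - s) * t j) (fun j => by
              refine Fin.cases ?_ (fun j => ?_) j
              · simpa
              · simpa using mul_nonneg h1 (ht j)) (by
              rw [Fin.sum_univ_succ]
              simp only [Fin.cons_zero, Fin.cons_succ, ← mul_sum]
              nlinarith)
            simp only [Fin.prod_univ_succ, Fin.cons_zero, Fin.cons_succ, mul_pow,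
              prod_mul_distrib, prod_pow_eq_pow_sum] at this
            simpa only [mul_assoc] using this
        refine le_of_eq_of_le (congrArg abs (sum_congr rfl fun i _ => ?_)) this
        ring
    refine le_of_eq_of_le (congrArg abs (sum_congr rfl fun i _ => ?_)) key
    have := (poch_pos hb (∑ j, m i (Fin.succ j))).ne'
    rw [Fin.prod_univ_succ, Fin.sum_univ_succ, Fin.sum_univ_succ,
      show a₀ + (a 0 + ∑ j, a (Fin.succ j)) = a 0 + (a₀ + ∑ j, a (Fin.succ j)) by ring]
    field_simp

end ErdelyiLaguerre

end

/-! ### Coefficients of the generating function. -/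

noncomputable section

namespace ErdelyiLaguerre

open Finset

lemma xzSum_eq_coe {k : ℕ} (x : Fin k → ℝ) :
    xzSum x = ((∑ j, x j • MvPolynomial.X j : MvPolynomial (Fin k) ℝ) :
      MvPowerSeries (Fin k) ℝ) := by
  rw [xzSum, ← MvPolynomial.coeToMvPowerSeries.ringHom_apply, map_sum]
  simp [MvPolynomial.smul_eq_C_mul]

lemma zSum_eq_xzSum (k : ℕ) : zSum k = xzSum (fun _ : Fin k => (1 : ℝ)) := by
  simp [zSum, xzSum]

lemma cast_multinomial {k : ℕ} (e : Fin k →₀ ℕ) :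
    (e.multinomial : ℝ) = (∑ j, e j).factorial / ∏ j, (e j).factorial := by
  rw [← Finsupp.multinomial_of_support_subset (subset_univ _), eq_div_iff (by positivity), mul_comm]
  exact_mod_cast Nat.multinomial_spec (univ : Finset (Fin k)) e

lemma coeff_xzSum_pow {k : ℕ} (x : Fin k → ℝ) (e : Fin k →₀ ℕ) (d : ℕ) :
    MvPowerSeries.coeff e (xzSum x ^ d) = if ∑ j, e j = d then
      ((∑ j, e j).factorial / ∏ j, ((e j).factorial : ℝ)) * ∏ j, x j ^ e j else 0 := by
  rw [xzSum_eq_coe, ← MvPolynomial.coe_pow, MvPolynomial.coeff_coe,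
    MvPolynomial.coeff_linearCombination_X_pow_of_fintype, cast_multinomial,
    Finsupp.sum_fintype _ _ (fun _ => rfl), Finsupp.prod_fintype _ _ (fun _ => pow_zero _)]
  norm_cast

lemma coeff_binomialSeries_subst {k : ℕ} (c : ℝ) (e : Fin k →₀ ℕ) :
    MvPowerSeries.coeff e ((PowerSeries.binomialSeries ℝ (-c)).subst (-zSum k)) =
      poch c (∑ j, e j) / ∏ j, ((e j).factorial : ℝ) := by
  have hcoeff : ∀ d, MvPowerSeries.coeff e ((-zSum k) ^ d) =
      (-1) ^ d * MvPowerSeries.coeff e (zSum k ^ d) := fun d => by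
    rcases Nat.even_or_odd d with h | h <;> simp [h.neg_pow]
  rw [PowerSeries.coeff_subst (hasSubst_neg_zSum k), finsum_eq_single _ (∑ j, e j)]
  · rw [hcoeff, zSum_eq_xzSum, coeff_xzSum_pow, if_pos rfl, PowerSeries.binomialSeries_coeff,
      choose_neg_eq_poch]
    have h1 : ((-1 : ℝ) ^ ∑ j, e j) * (-1) ^ ∑ j, e j = 1 := by
      rw [← mul_pow]; simp
    simp only [one_pow, prod_const_one, mul_one, smul_eq_mul]
    field_simp
    linear_combination (poch c (∑ j, e j)) * h1
  · intro d hd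
    rw [hcoeff, zSum_eq_xzSum, coeff_xzSum_pow, if_neg hd.symm]
    simp

lemma binomialSeries_subst_mul_inv_pow (k : ℕ) (r : ℝ) (d : ℕ) :
    (PowerSeries.binomialSeries ℝ r).subst (-zSum k) * (1 - zSum k)⁻¹ ^ d =
      (PowerSeries.binomialSeries ℝ (r - d)).subst (-zSum k) := by
  have hs := hasSubst_neg_zSum k
  have h1 : (PowerSeries.binomialSeries ℝ (1 : ℝ)).subst (-zSum k) = 1 - zSum k := by
    have h := PowerSeries.binomialSeries_nat (R := ℝ) (A := ℝ) 1
    rw [Nat.cast_one, pow_one] at h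
    rw [h, ← PowerSeries.coe_substAlgHom hs, map_add, map_one, PowerSeries.coe_substAlgHom hs,
      PowerSeries.subst_X hs, sub_eq_add_neg]
  induction d with
  | zero => simp
  | succ d ih =>
    have h2 : r - d = (r - (d + 1 : ℕ)) + 1 := by push_cast; ring
    rw [pow_succ, ← mul_assoc, ih, h2, PowerSeries.binomialSeries_add, PowerSeries.subst_mul hs,
      h1, mul_assoc, one_sub_zSum_mul_inv, mul_one]

lemma coeff_exponent_pow_eq_zero {k : ℕ} (x : Fin k → ℝ) (e : Fin k →₀ ℕ) {d : ℕ}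
    (h : e.degree < d) :
    MvPowerSeries.coeff e ((-(xzSum x * (1 - zSum k)⁻¹)) ^ d) = 0 :=
  MvPowerSeries.coeff_of_lt_order <| lt_of_lt_of_le (by exact_mod_cast h)
    (MvPowerSeries.le_order_pow_of_constantCoeff_eq_zero d (by simp [xzSum]))

lemma coeff_exp_subst {k : ℕ} (x : Fin k → ℝ) (e : Fin k →₀ ℕ) {D : ℕ} (h : e.degree ≤ D) :
    MvPowerSeries.coeff e ((PowerSeries.exp ℝ).subst (-(xzSum x * (1 - zSum k)⁻¹))) =
      ∑ d ∈ range (D + 1),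
        (d.factorial : ℝ)⁻¹ * MvPowerSeries.coeff e ((-(xzSum x * (1 - zSum k)⁻¹)) ^ d) := by
  rw [PowerSeries.coeff_subst (hasSubst_exponent x),
    finsum_eq_sum_of_support_subset (s := range (D + 1))]
  · simp [PowerSeries.coeff_exp]
  · intro d hd
    by_contra hlt
    have : e.degree < d := by
      have : D + 1 ≤ d := by simpa using hlt
      omega
    exact hd (by simp [coeff_exponent_pow_eq_zero x e this])

/-- The explicit formula for Erdélyi's multivariate Laguerre polynomials. -/
theorem laguerre_eq_sum {k : ℕ} {α : ℝ} (hα : 0 < α + 1) (n : Fin k → ℕ) (x : Fin k → ℝ) :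
    laguerre α n x = poch (α + 1) (∑ j, n j) *
      ∑ p ∈ antidiagonal (Finsupp.equivFunOnFinite.symm n),
        (∏ j, (-x j) ^ p.1 j / ((p.1 j).factorial * (p.2 j).factorial)) /
          poch (α + 1) (∑ j, p.1 j) := by
  set N := Finsupp.equivFunOnFinite.symm n with hN
  have hdeg : ∀ p ∈ antidiagonal N, p.1.degree + p.2.degree = N.degree := fun p hp => by
    rw [← HasAntidiagonal.mem_antidiagonal.1 hp, map_add]
  -- Powers of the exponent contribute `(1 - zSum k)⁻¹ ^ d`, which the binomial series absorbs. The
  -- cutoff `N.degree` is common to all terms, so the sums can be exchanged.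
  have step : laguerre α n x = ∑ d ∈ range (N.degree + 1), (d.factorial : ℝ)⁻¹ *
      MvPowerSeries.coeff N (((-1) ^ d * xzSum x ^ d) *
        (PowerSeries.binomialSeries ℝ (-(α + 1 + d))).subst (-zSum k)) := by
    rw [laguerre, generatingSeries, MvPowerSeries.coeff_mul]
    rw [sum_congr rfl fun p hp => by
      rw [coeff_exp_subst x p.2 (D := N.degree) (by have := hdeg p hp; omega), mul_sum]]
    rw [sum_comm]
    refine sum_congr rfl fun d _ => ?_
    rw [show -(α + 1 + d) = -α - 1 - d by ring, ← binomialSeries_subst_mul_inv_pow,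
      show (-1) ^ d * xzSum x ^ d * ((PowerSeries.binomialSeries ℝ (-α - 1)).subst (-zSum k) *
        (1 - zSum k)⁻¹ ^ d) = (PowerSeries.binomialSeries ℝ (-α - 1)).subst (-zSum k) *
        (-(xzSum x * (1 - zSum k)⁻¹)) ^ d by
          rw [neg_pow (xzSum x * _), mul_pow (xzSum x)]; ring,
      MvPowerSeries.coeff_mul, mul_sum]
    exact sum_congr rfl fun p _ => by ring
  have hneg : ∀ (d : ℕ) (e : Fin k →₀ ℕ), MvPowerSeries.coeff e ((-1) ^ d * xzSum x ^ d) =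
      (-1) ^ d * MvPowerSeries.coeff e (xzSum x ^ d) := fun d e => by
    rcases Nat.even_or_odd d with h | h <;> rw [h.neg_one_pow, h.neg_one_pow] <;>
      simp only [one_mul, neg_mul, map_neg]
  rw [step]
  rw [sum_congr rfl fun d _ => by rw [MvPowerSeries.coeff_mul]]
  simp_rw [coeff_binomialSeries_subst, hneg, mul_sum]
  rw [sum_comm]
  refine sum_congr rfl fun p hp => ?_
  have hp1 : p.1.degree = ∑ j, p.1 j := Finsupp.degree_eq_sum _
  -- `xzSum x ^ d` is homogeneous of degree `d`, so only one `d` survives.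
  rw [sum_eq_single (∑ j, p.1 j)]
  · have hn : ∑ j, n j = ∑ j, p.1 j + ∑ j, p.2 j := by
      rw [← sum_add_distrib]
      refine sum_congr rfl fun j _ => ?_
      have := DFunLike.congr_fun (HasAntidiagonal.mem_antidiagonal.1 hp) j
      simpa [hN] using this.symm
    have := (poch_pos hα (∑ j, p.1 j)).ne'
    rw [coeff_xzSum_pow, if_pos rfl, hn, poch_add, prod_div_distrib, prod_mul_distrib]
    simp_rw [neg_pow (x _)]
    rw [prod_mul_distrib, prod_pow_eq_pow_sum]
    field_simp
  · intro d _ hd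
    rw [coeff_xzSum_pow, if_neg hd.symm]
    simp
  · intro h
    have := hdeg p hp
    rw [mem_range] at h
    omega

lemma prod_sum_antidiagonal {k : ℕ} (n : Fin k → ℕ) (g : Fin k → ℕ × ℕ → ℝ) :
    ∏ j, ∑ r ∈ antidiagonal (n j), g j r =
      ∑ p ∈ antidiagonal (Finsupp.equivFunOnFinite.symm n), ∏ j, g j (p.1 j, p.2 j) := by
  rw [prod_univ_sum]
  refine sum_bij' (fun f _ => (Finsupp.equivFunOnFinite.symm fun j => (f j).1,
    Finsupp.equivFunOnFinite.symm fun j => (f j).2)) (fun p _ j => (p.1 j, p.2 j)) ?_ ?_ ?_ ?_ ?_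
  · intro f hf
    rw [HasAntidiagonal.mem_antidiagonal]
    ext j
    simpa using HasAntidiagonal.mem_antidiagonal.1 (Fintype.mem_piFinset.1 hf j)
  · intro p hp
    refine Fintype.mem_piFinset.2 fun j => ?_
    rw [HasAntidiagonal.mem_antidiagonal]
    simpa using DFunLike.congr_fun (HasAntidiagonal.mem_antidiagonal.1 hp) j
  · intro f _
    rfl
  · intro p _
    ext <;> simp
  · intro f _
    rfl

lemma prod_abs_laguerreSum_le {k : ℕ} {a : ℝ} (ha : 0 < a) (ha' : a ≤ 1 / 2)
    (n : Fin k → ℕ) {x t : Fin k → ℝ} (hx : ∀ j, 0 ≤ x j) (ht : ∀ j, 0 ≤ t j)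
    (ht1 : ∑ j, t j ≤ 1) :
    |∏ j, laguerreSum a (n j) (x j * t j)| ≤
      (∏ j, 2 ^ (1 - a) * q (n j) / poch a (n j)) * Real.exp (‖x‖ / 2) := by
  have hle : ∀ j, |laguerreSum a (n j) (x j * t j)| ≤
      2 ^ (1 - a) * q (n j) / poch a (n j) * Real.exp (x j * t j / 2) := fun j => by
    have hp := poch_pos ha (n j)
    have h := abs_poch_mul_laguerreSum_le ha ha' (n j) (mul_nonneg (hx j) (ht j))
    rw [abs_mul, abs_of_pos hp] at h
    rw [div_mul_eq_mul_div, le_div_iff₀ hp]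
    linarith
  have hq : ∀ j, 0 ≤ 2 ^ (1 - a) * q (n j) / poch a (n j) := fun j => by
    have := q_pos (n j)
    have := poch_pos ha (n j)
    positivity
  rw [abs_prod]
  refine (prod_le_prod (fun _ _ => abs_nonneg _) fun j _ => hle j).trans ?_
  rw [prod_mul_distrib, ← Real.exp_sum, ← sum_div]
  refine mul_le_mul_of_nonneg_left ?_ (prod_nonneg fun j _ => hq j)
  gcongr
  calc ∑ j, x j * t j ≤ ∑ j, ‖x‖ * t j := sum_le_sum fun j _ =>
        mul_le_mul_of_nonneg_right ((le_abs_self _).trans (norm_le_pi_norm x j)) (ht j)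
    _ = ‖x‖ * ∑ j, t j := (mul_sum _ _ _).symm
    _ ≤ ‖x‖ := mul_le_of_le_one_right (norm_nonneg x) ht1

end ErdelyiLaguerre

end

/-! ### Assembly of the bound. -/

theorem theorem1p2 (k : ℕ) (hk : 1 ≤ k) (α : ℝ) (hα : -(1 / 2) < α)
    (n : Fin k → ℕ) (x : Fin k → ℝ) (hx : ∀ j, 0 ≤ x j) :
    |ErdelyiLaguerre.laguerre α n x| ≤
      (∏ j, ErdelyiLaguerre.q (n j)) * (2 : ℝ) ^ ((k : ℝ) - 1 / 2) *
        (ErdelyiLaguerre.poch (α + 1) (∑ j, n j) /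
          ∏ j, ErdelyiLaguerre.poch (1 / (2 * (k : ℝ))) (n j)) *
        Real.exp (‖x‖ / 2) := by
  open ErdelyiLaguerre in
  have hk' : (1 : ℝ) ≤ k := by exact_mod_cast hk
  -- The `k` weights sum to `1/2`, leaving the slack weight `α + 1/2`, positive exactly when `α >
  -- -1/2`; also `a ≤ 1/2`, as Rooney's inequality requires.
  set a : ℝ := 1 / (2 * (k : ℝ)) with ha_def
  have ha : 0 < a := by positivity
  have ha' : a ≤ 1 / 2 := one_div_le_one_div_of_le (by norm_num) (by linarith)
  have hka : k * a = 1 / 2 := by rw [ha_def]; field_simp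
  have key := abs_sum_dirichlet_le
    (Finset.HasAntidiagonal.antidiagonal (Finsupp.equivFunOnFinite.symm n))
    (M := (∏ j, 2 ^ (1 - a) * q (n j) / poch a (n j)) * Real.exp (‖x‖ / 2))
    (a₀ := α + 1 / 2) (by linarith) (fun _ : Fin k => a) (fun _ => ha) (fun p => p.1)
    (fun p => ∏ j, (-x j) ^ p.1 j / ((p.1 j).factorial * (p.2 j).factorial * poch a (p.1 j)))
    fun t ht ht1 => by
      refine le_of_eq_of_le (congrArg abs ?_) (prod_abs_laguerreSum_le ha ha' n hx ht ht1)
      simp only [laguerreSum]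
      rw [prod_sum_antidiagonal n fun j r =>
        (-(x j * t j)) ^ r.1 / (r.1.factorial * r.2.factorial * poch a r.1)]
      refine Finset.sum_congr rfl fun p _ => ?_
      rw [← Finset.prod_mul_distrib]
      refine Finset.prod_congr rfl fun j _ => ?_
      rw [← neg_mul, mul_pow, div_mul_eq_mul_div]
  rw [Finset.sum_const, Finset.card_univ, Fintype.card_fin, nsmul_eq_mul, hka,
    show α + 1 / 2 + 1 / 2 = α + 1 by ring] at key
  have hα1 : 0 < α + 1 := by linarith
  have hP := poch_pos hα1 (∑ j, n j)
  rw [laguerre_eq_sum hα1, abs_mul, abs_of_pos hP]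
  have hpow : ∏ _j : Fin k, (2 : ℝ) ^ (1 - a) = 2 ^ ((k : ℝ) - 1 / 2) := by
    rw [Finset.prod_const, Finset.card_univ, Fintype.card_fin, ← Real.rpow_mul_natCast (by norm_num),
      show (1 - a) * k = k - k * a by ring, hka]
  rw [Finset.prod_div_distrib, Finset.prod_mul_distrib, hpow] at key
  refine (mul_le_mul_of_nonneg_left (le_of_eq_of_le (congrArg abs
    (Finset.sum_congr rfl fun p _ => ?_)) key) hP.le).trans_eq ?_
  · rw [← mul_div_assoc, ← Finset.prod_mul_distrib]
    congr 1
    refine Finset.prod_congr rfl fun j _ => ?_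
    have := (poch_pos ha (p.1 j)).ne'
    field_simp
  · ring
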